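/- Let $M$ be a smooth (Hausdorff, paracompact) manifold and let $(\mathcal A,\ast,a)$ be a left-symmetric algebroid over $M$: a smooth real vector bundle $\mathcal A\to M$ of finite rank with an $\mathbb R$-bilinear product $\ast$ on $\Gamma(\mathcal A)$ whose associator $x\ast(y\ast z)-(x\ast y)\ast z$ is symmetric in $x,y$, and a bundle map $a\colon\mathcal A\to TM$ with $x\ast(fy)=f(x\ast y)+a(x)(f)\,y$ and $(fx)\ast y=f(x\ast y)$ for $f\in C^\infty(M)$. Put $[x,y]=x\ast y-y\ast x$ and, for $\xi\in\Gamma(\mathcal A^*)$, $\langle L_x\xi,y\rangle=a(x)\langle\xi,y\rangle-\langle\xi,x\ast y\rangle$ and $\langle R_x\xi,y\rangle=-\langle\xi,y\ast x\rangle$. For $H\in\mathrm{Sym}^2(\mathcal A)$ let $H^\sharp\colon\mathcal A^*\to\mathcal A$, $\langle H^\sharp(\alpha),\beta\rangle=H(\alpha,\beta)$, and $$[H,H](\alpha_1,\alpha_2,\alpha_3)=a(H^\sharp\alpha_1)\langle H^\sharp\alpha_2,\alpha_3\rangle-a(H^\sharp\alpha_2)\langle H^\sharp\alpha_1,\alpha_3\rangle+\langle\alpha_1,H^\sharp\alpha_2\ast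 H^\sharp\alpha_3\rangle-\langle\alpha_2,H^\sharp\alpha_1\ast H^\sharp\alpha_3\rangle-\langle\alpha_3,[H^\sharp\alpha_1,H^\sharp\alpha_2]\rangle .$$ $H$ is a Koszul–Vinberg structure if $[H,H]=0$. Let $C_{\rm KV}^{k}(\mathcal A^*)=\Gamma(\wedge^{k-1}\mathcal A\otimes\mathcal A)\cong\Gamma(\mathrm{Hom}(\wedge^{k-1}\mathcal A^*,\mathcal A))$, $k\ge1$, where $P$ is evaluated by $P(\alpha_1,\dots,\alpha_k)=\langle P(\alpha_1,\dots,\alpha_{k-1}),\alpha_k\rangle$. For $P\in\Gamma(\mathrm{Hom}(\wedge^{p}\mathcal A^*,\mathcal A))$ and $Q\in\Gamma(\mathrm{Hom}(\wedge^{q}\mathcal A^*,\mathcal A))$ let $$[\![P,Q]\!](\alpha_1,\dots,\alpha_{p+q})=\sum_{\sigma\in\mathbb S_{(q,1,p-1)}}(-1)^\sigma P(L_{Q(\alpha_{\sigma(1)},\dots,\alpha_{\sigma(q)})}\alpha_{\sigma(q+1)},\alpha_{\sigma(q+2)},\dots,\alpha_{\sigma(p+q)})$$ $$-(-1)^{pq}\sum_{\sigma\in\mathbb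 S_{(p,1,q-1)}}(-1)^\sigma Q(L_{P(\alpha_{\sigma(1)},\dots,\alpha_{\sigma(p)})}\alpha_{\sigma(p+1)},\alpha_{\sigma(p+2)},\dots,\alpha_{\sigma(p+q)})$$ $$+(-1)^{pq}\sum_{\sigma\in\mathbb S_{(p,q)}}(-1)^\sigma[P(\alpha_{\sigma(1)},\dots,\alpha_{\sigma(p)}),Q(\alpha_{\sigma(p+1)},\dots,\alpha_{\sigma(p+q)})],$$ where $\mathbb S_{(\cdot)}$ denotes unshuffles and a sum over unshuffles with a block of size $-1$ is empty. For a Koszul–Vinberg structure $H$ put $\delta\varphi=(-1)^{k-1}[\![H,\varphi]\!]$ for $\varphi\in C^k_{\rm KV}(\mathcal A^*)$, and let $\tilde C_{\rm KV}^1=\{x\mid H(R_x\alpha_1,\alpha_2)=H(\alpha_1,R_x\alpha_2)\}$, $\tilde C_{\rm KV}^2=\{\varphi\mid\varphi(\alpha_1,\alpha_2)=\varphi(\alpha_2,\alpha_1)\}$, $\tilde C_{\rm KV}^3=\{\varphi\mid\varphi(\alpha_1,\alpha_2,\alpha_3)+\varphi(\alpha_2,\alpha_3,\alpha_1)+\varphi(\alpha_3,\alpha_1,\alpha_2)=0\}$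 and $\tilde C_{\rm KV}^k=C_{\rm KV}^k$ for $k\ge4$. An infinitesimal deformation of $H$ is $H_t=H+t\mathcal H_1$ with $\mathcal H_1\in\mathrm{Sym}^2(\mathcal A)$ and $[H_t,H_t]=0$ modulo $t^2$ (operations extended $t$-linearly). Two of them, $H_t$ and $H'_t$, are equivalent if there is a formal series $\mathcal X_t=\sum_{i\ge1}x_it^i$, $x_i\in\Gamma(\mathcal A)$, with $\exp(\mathrm{ad}_{\mathcal X_t})H_t=H'_t$ modulo $t^2$, where $\mathrm{ad}_{\mathcal X_t}=[\![\mathcal X_t,\cdot\,]\!]$. **Proposition.** Let $H$ be a Koszul–Vinberg structure on $(\mathcal A,\ast,a)$. Then $\delta\tilde C_{\rm KV}^1\subset\tilde C_{\rm KV}^2$, $\delta\tilde C_{\rm KV}^2\subset\tilde C_{\rm KV}^3$ and $\delta\circ\delta=0$ on $\tilde C_{\rm KV}^1$. Equivalence is an equivalence relation on the infinitesimal deformations of $H$, every infinitesimal deformation $H+t\mathcal H_1$ satisfies $\delta\mathcal H_1=0$, and $H+t\mathcal H_1\mapsto[\mathcal H_1]$ induces a bijection from the set of equivalence classes of infinitesimal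 deformations of $H$ onto the second cohomology group $$\tilde H^2_{\rm KV}(\mathcal A^*)=\ker(\delta\colon\tilde C_{\rm KV}^2\to\tilde C_{\rm KV}^3)\,/\,\delta(\tilde C_{\rm KV}^1).$$ -/

import Mathlib

open scoped Manifold ContDiff Bundle

noncomputable section

namespace KoszulVinberg

/-! ### Sections of a vector bundle as a module over the smooth functions -/

section Sections

variable {n : ℕ} {M : Type*} [TopologicalSpace M] [ChartedSpace (EuclideanSpace ℝ (Fin n)) M]
  {F : Type*} [NormedAddCommGroup F] [NormedSpace ℝ F]
  {V : M → Type*} [TopologicalSpace (Bundle.TotalSpace F V)]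
  [∀ p, TopologicalSpace (V p)] [FiberBundle F V]
  [∀ p, AddCommGroup (V p)] [∀ p, Module ℝ (V p)] [VectorBundle ℝ F V]

/-- Pointwise multiplication of a smooth section by a smooth function. -/
instance sectionSMul : SMul C^∞⟮𝓡 n, M; ℝ⟯ Cₛ^∞⟮𝓡 n; F, V⟯ :=
  ⟨fun f s => ⟨fun p => f p • s p, f.contMDiff.smul_section s.contMDiff⟩⟩

theorem section_smul_apply (f : C^∞⟮𝓡 n, M; ℝ⟯) (s : Cₛ^∞⟮𝓡 n; F, V⟯) (p : M) :
    (f • s) p = f p • s p := rfl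

/-- `Γ(V)` is a module over `C^∞(M)`. -/
instance sectionModule : Module C^∞⟮𝓡 n, M; ℝ⟯ Cₛ^∞⟮𝓡 n; F, V⟯ where
  one_smul s := by ext p; simp [section_smul_apply]
  mul_smul f g s := by ext p; exact mul_smul (f p) (g p) (s p)
  smul_zero f := by ext p; simp [section_smul_apply]
  smul_add f s t := by ext p; simp [section_smul_apply, smul_add]
  add_smul f g s := by ext p; exact add_smul (f p) (g p) (s p)
  zero_smul s := by ext p; simp [section_smul_apply]

instance sectionTower : IsScalarTower ℝ C^∞⟮𝓡 n, M; ℝ⟯ Cₛ^∞⟮𝓡 n; F, V⟯ where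
  smul_assoc r f s := by ext p; exact mul_smul r (f p) (s p)

instance sectionSMulComm : SMulCommClass C^∞⟮𝓡 n, M; ℝ⟯ ℝ Cₛ^∞⟮𝓡 n; F, V⟯ where
  smul_comm f r s := by ext p; exact smul_comm (f p) r (s p)

end Sections

/-! ### Vector fields along an anchor acting on functions -/

section Anchor

variable {n : ℕ} {M : Type*} [TopologicalSpace M] [ChartedSpace (EuclideanSpace ℝ (Fin n)) M]
  [IsManifold (𝓡 n) ∞ M]
  {F : Type*} [NormedAddCommGroup F] [NormedSpace ℝ F]
  {V : M → Type*} [TopologicalSpace (Bundle.TotalSpace F V)]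
  [∀ p, TopologicalSpace (V p)] [FiberBundle F V]
  [∀ p, AddCommGroup (V p)] [∀ p, Module ℝ (V p)] [VectorBundle ℝ F V]

/-- A smooth vector bundle morphism `V → TM` over the identity: a smooth section of the bundle
`Hom(V, TM)`. -/
abbrev BundleAnchor (n : ℕ) (M : Type*) [TopologicalSpace M]
    [ChartedSpace (EuclideanSpace ℝ (Fin n)) M] [IsManifold (𝓡 n) ∞ M]
    (F : Type*) [NormedAddCommGroup F] [NormedSpace ℝ F]
    (V : M → Type*) [TopologicalSpace (Bundle.TotalSpace F V)]
    [∀ p, TopologicalSpace (V p)] [FiberBundle F V]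
    [∀ p, AddCommGroup (V p)] [∀ p, Module ℝ (V p)] [VectorBundle ℝ F V] :=
  Cₛ^∞⟮𝓡 n; F →L[ℝ] EuclideanSpace ℝ (Fin n), fun p : M => V p →L[ℝ] TangentSpace (𝓡 n) p⟯

theorem contMDiff_anchor_apply (a : BundleAnchor n M F V) (x : Cₛ^∞⟮𝓡 n; F, V⟯)
    (f : C^∞⟮𝓡 n, M; ℝ⟯) :
    ContMDiff (𝓡 n) 𝓘(ℝ, ℝ) ∞
      (fun p : M => (mfderiv (𝓡 n) 𝓘(ℝ, ℝ) f p (a p (x p)) : ℝ)) := by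
  have : IsManifold (𝓡 n) 1 M := IsManifold.of_le (n := ∞) (by norm_cast)
  have h1 := ContMDiff.clm_bundle_apply (F₁ := F) (F₂ := EuclideanSpace ℝ (Fin n))
    (E₁ := V) (E₂ := fun p : M => TangentSpace (𝓡 n) p) (b := fun p : M => p) a.contMDiff x.contMDiff
  have h2 := (f.contMDiff.contMDiff_tangentMap (m := ∞) (by simp)).comp h1
  intro p
  have h3 := (Bundle.contMDiffAt_totalSpace.1 (h2 p)).2
  simpa [Function.comp_def, tangentMap] using h3

/-- The function `a(x)(f)`: the derivative of `f` in the direction of the vector field `a ∘ x`. -/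
def anchorAct (a : BundleAnchor n M F V) (x : Cₛ^∞⟮𝓡 n; F, V⟯) (f : C^∞⟮𝓡 n, M; ℝ⟯) :
    C^∞⟮𝓡 n, M; ℝ⟯ :=
  ⟨fun p => mfderiv (𝓡 n) 𝓘(ℝ, ℝ) f p (a p (x p)), contMDiff_anchor_apply a x f⟩

theorem anchorAct_apply (a : BundleAnchor n M F V) (x : Cₛ^∞⟮𝓡 n; F, V⟯) (f : C^∞⟮𝓡 n, M; ℝ⟯)
    (p : M) : anchorAct a x f p = (mfderiv (𝓡 n) 𝓘(ℝ, ℝ) f p (a p (x p)) : ℝ) := rfl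

theorem anchorAct_add (a : BundleAnchor n M F V) (x : Cₛ^∞⟮𝓡 n; F, V⟯) (f g : C^∞⟮𝓡 n, M; ℝ⟯) :
    anchorAct a x (f + g) = anchorAct a x f + anchorAct a x g := by
  ext p
  have h := mfderiv_add (f.mdifferentiableAt (x := p)) (g.mdifferentiableAt (x := p))
  exact congrArg (fun D : EuclideanSpace ℝ (Fin n) →L[ℝ] ℝ => D (a p (x p))) h

theorem anchorAct_mul (a : BundleAnchor n M F V) (x : Cₛ^∞⟮𝓡 n; F, V⟯) (f g : C^∞⟮𝓡 n, M; ℝ⟯) :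
    anchorAct a x (f * g) = f * anchorAct a x g + anchorAct a x f * g := by
  ext p
  have h := (f.mdifferentiableAt (x := p)).hasMFDerivAt.mul
    (g.mdifferentiableAt (x := p)).hasMFDerivAt
  have h' := congrArg (fun D : EuclideanSpace ℝ (Fin n) →L[ℝ] ℝ => D (a p (x p))) h.mfderiv
  refine h'.trans ?_
  change f p * anchorAct a x g p + g p * anchorAct a x f p = _
  rw [mul_comm (g p)]
  rfl

theorem anchorAct_add_left (a : BundleAnchor n M F V) (x y : Cₛ^∞⟮𝓡 n; F, V⟯)
    (f : C^∞⟮𝓡 n, M; ℝ⟯) : anchorAct a (x + y) f = anchorAct a x f + anchorAct a y f := by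
  ext p
  simp [anchorAct_apply]
  rfl

theorem anchorAct_smul_left (a : BundleAnchor n M F V) (r : ℝ) (x : Cₛ^∞⟮𝓡 n; F, V⟯)
    (f : C^∞⟮𝓡 n, M; ℝ⟯) : anchorAct a (r • x) f = r • anchorAct a x f := by
  ext p
  simp [anchorAct_apply]
  rfl

end Anchor

/-! ### Left-symmetric algebroids -/

/-- A left-symmetric algebroid structure on the smooth real vector bundle `V → M`. -/
structure LeftSymmetricAlgebroid (n : ℕ) (M : Type*) [TopologicalSpace M]
    [ChartedSpace (EuclideanSpace ℝ (Fin n)) M] [IsManifold (𝓡 n) ∞ M]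
    (F : Type*) [NormedAddCommGroup F] [NormedSpace ℝ F]
    (V : M → Type*) [TopologicalSpace (Bundle.TotalSpace F V)]
    [∀ p, TopologicalSpace (V p)] [FiberBundle F V]
    [∀ p, AddCommGroup (V p)] [∀ p, Module ℝ (V p)] [VectorBundle ℝ F V] where
  /-- The bilinear multiplication `x ∗ y` on sections. -/
  mul : Cₛ^∞⟮𝓡 n; F, V⟯ →ₗ[ℝ] Cₛ^∞⟮𝓡 n; F, V⟯ →ₗ[ℝ] Cₛ^∞⟮𝓡 n; F, V⟯
  /-- The anchor, a vector bundle morphism `V → TM`. -/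
  anchor : BundleAnchor n M F V
  /-- The associator is symmetric in its first two arguments. -/
  left_symm : ∀ x y z,
    mul x (mul y z) - mul (mul x y) z = mul y (mul x z) - mul (mul y x) z
  mul_smul_right : ∀ (f : C^∞⟮𝓡 n, M; ℝ⟯) x y,
    mul x (f • y) = f • mul x y + anchorAct anchor x f • y
  mul_smul_left : ∀ (f : C^∞⟮𝓡 n, M; ℝ⟯) x y, mul (f • x) y = f • mul x y

namespace LeftSymmetricAlgebroid

variable {n : ℕ} {M : Type*} [TopologicalSpace M] [ChartedSpace (EuclideanSpace ℝ (Fin n)) M]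
  [IsManifold (𝓡 n) ∞ M]
  {F : Type*} [NormedAddCommGroup F] [NormedSpace ℝ F]
  {V : M → Type*} [TopologicalSpace (Bundle.TotalSpace F V)]
  [∀ p, TopologicalSpace (V p)] [FiberBundle F V]
  [∀ p, AddCommGroup (V p)] [∀ p, Module ℝ (V p)] [VectorBundle ℝ F V]

/-- The algebra `C^∞(M)` of smooth functions on the base. -/
abbrev Fn (_A : LeftSymmetricAlgebroid n M F V) := C^∞⟮𝓡 n, M; ℝ⟯

/-- The module `Γ(A)` of smooth sections. -/
abbrev Sec (_A : LeftSymmetricAlgebroid n M F V) := Cₛ^∞⟮𝓡 n; F, V⟯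

/-- The module `Γ(A^*)` of sections of the dual bundle, in its standard description as the
`C^∞(M)`-linear maps `Γ(A) → C^∞(M)`; the pairing of `α` and `x` is `α x`. -/
abbrev Dual (A : LeftSymmetricAlgebroid n M F V) := Module.Dual A.Fn A.Sec

variable (A : LeftSymmetricAlgebroid n M F V)

/-- `a(x)(f)` for the anchor `a` of `A`. -/
def act (x : A.Sec) (f : A.Fn) : A.Fn := anchorAct A.anchor x f

/-- The bracket `[x, y] = x ∗ y - y ∗ x` of the sub-adjacent Lie algebroid. -/
def lie (x y : A.Sec) : A.Sec := A.mul x y - A.mul y x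

/-- `L_x ξ` on the dual: `⟨L_x ξ, y⟩ = a(x)⟨ξ, y⟩ - ⟨ξ, x ∗ y⟩`. -/
def dualL (x : A.Sec) (ξ : A.Dual) : A.Dual where
  toFun y := A.act x (ξ y) - ξ (A.mul x y)
  map_add' y z := by
    simp only [map_add, act, anchorAct_add]
    abel
  map_smul' f y := by
    simp only [map_smul, A.mul_smul_right, map_add, act, smul_eq_mul, anchorAct_mul,
      RingHom.id_apply]
    ring

/-- `R_x ξ` on the dual: `⟨R_x ξ, y⟩ = -⟨ξ, y ∗ x⟩`. -/
def dualR (x : A.Sec) (ξ : A.Dual) : A.Dual where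
  toFun y := -ξ (A.mul y x)
  map_add' y z := by
    simp only [map_add, LinearMap.add_apply]
    abel
  map_smul' f y := by
    simp only [A.mul_smul_left, map_smul, smul_eq_mul, RingHom.id_apply, mul_neg]

theorem dualL_apply (x : A.Sec) (ξ : A.Dual) (y : A.Sec) :
    A.dualL x ξ y = A.act x (ξ y) - ξ (A.mul x y) := rfl

/-! ### Cochains and the graded Lie bracket -/

/-- The cochains `C_KV^{k+1}(A^*) = Γ(Λ^k A ⊗ A)`, in the description as
`Γ(Hom(Λ^k A^*, A))`: alternating `C^∞(M)`-multilinear maps `Γ(A^*)^k → Γ(A)`. The cochain `P` is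
evaluated on `k + 1` sections of `A^*` by `P(α₁, …, α_{k+1}) = ⟨P(α₁, …, α_k), α_{k+1}⟩`. In
particular `Cochain 0` is `Γ(A)` and `Cochain 1` is `Γ(A ⊗ A)`.
All indices below are shifted in the same way: the index `k` belongs to the degree `k + 1`. -/
abbrev Cochain (k : ℕ) := A.Dual [⋀^Fin k]→ₗ[A.Fn] A.Sec

/-- `σ` is increasing on the positions `a, …, b - 1`. -/
def IncreasingOn {N : ℕ} (σ : Equiv.Perm (Fin N)) (a b : ℕ) : Prop :=
  ∀ i j : Fin N, a ≤ (i : ℕ) → i < j → (j : ℕ) < b → σ i < σ j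

open Classical in
/-- The unshuffles of type `(q, 1, p - 1)`; there are none if `p = 0`. -/
def unshuffles₃ (q p : ℕ) : Finset (Equiv.Perm (Fin (q + p))) :=
  {σ | 0 < p ∧ IncreasingOn σ 0 q ∧ IncreasingOn σ (q + 1) (q + p)}

open Classical in
/-- The unshuffles of type `(p, q)`. -/
def unshuffles₂ (p q : ℕ) : Finset (Equiv.Perm (Fin (q + p))) :=
  {σ | IncreasingOn σ 0 p ∧ IncreasingOn σ p (q + p)}

/-- `∑ (-1)^σ P(L_{Q(u_{σ(1)}, …, u_{σ(q)})} u_{σ(q+1)}, u_{σ(q+2)}, …, u_{σ(q+p)})`, the sum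
being over the unshuffles of type `(q, 1, p - 1)`. -/
def insertion {p q : ℕ} (P : (Fin p → A.Dual) → A.Sec) (Q : (Fin q → A.Dual) → A.Sec)
    (u : Fin (q + p) → A.Dual) : A.Sec :=
  ∑ σ ∈ unshuffles₃ q p, (Equiv.Perm.sign σ : ℤ) •
    P (fun i => if (i : ℕ) = 0
      then A.dualL (Q fun j => u (σ (Fin.castAdd p j))) (u (σ (Fin.natAdd q i)))
      else u (σ (Fin.natAdd q i)))

/-- The graded Lie bracket of `P` of degree `p` and `Q` of degree `q` on
`⊕ Γ(Hom(Λ^k A^*, A)) = ⊕ Γ(Λ^k A ⊗ A)` attached to the sub-adjacent Lie algebroid of `A` and its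
representation `L` on `A^*`. -/
def bracket {p q : ℕ} (P : (Fin p → A.Dual) → A.Sec) (Q : (Fin q → A.Dual) → A.Sec)
    (u : Fin (q + p) → A.Dual) : A.Sec :=
  A.insertion P Q u
    - (-1 : ℤ) ^ (p * q) • A.insertion Q P (fun i => u (Fin.cast (Nat.add_comm p q) i))
    + (-1 : ℤ) ^ (p * q) • ∑ σ ∈ unshuffles₂ p q, (Equiv.Perm.sign σ : ℤ) •
        A.lie (P fun i => u (σ (Fin.cast (Nat.add_comm p q) (Fin.castAdd q i))))
          (Q fun j => u (σ (Fin.cast (Nat.add_comm p q) (Fin.natAdd p j))))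

/-! ### Koszul–Vinberg structures -/

/-- `H^♯(α)`. -/
def sharp (H : A.Cochain 1) (α : A.Dual) : A.Sec := H ![α]

/-- `H(α, β) = ⟨H^♯(α), β⟩`. -/
def eval₂ (H : A.Cochain 1) (α β : A.Dual) : A.Fn := β (A.sharp H α)

/-- `Sym²(A)`, as a real vector space. -/
def Sym2 : Submodule ℝ (A.Cochain 1) where
  carrier := {H | ∀ α β, A.eval₂ H α β = A.eval₂ H β α}
  add_mem' {H K} hH hK α β := by
    have h1 := hH α β
    have h2 := hK α β
    simp only [eval₂, sharp, AlternatingMap.add_apply, map_add] at *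
    rw [h1, h2]
  zero_mem' α β := by simp [eval₂, sharp]
  smul_mem' r H hH α β := by
    have h1 := hH α β
    simp only [eval₂, sharp, AlternatingMap.smul_apply, LinearMap.map_smul_of_tower] at *
    rw [h1]

/-- The expression whose diagonal value `kv H H` is `[H, H](α₁, α₂, α₃)`. -/
def kv (H K : A.Cochain 1) (α₁ α₂ α₃ : A.Dual) : A.Fn :=
  A.act (A.sharp H α₁) (α₃ (A.sharp K α₂)) - A.act (A.sharp H α₂) (α₃ (A.sharp K α₁))
    + α₁ (A.mul (A.sharp H α₂) (A.sharp K α₃)) - α₂ (A.mul (A.sharp H α₁) (A.sharp K α₃))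
    - α₃ (A.lie (A.sharp H α₁) (A.sharp K α₂))

/-- `H` is a Koszul–Vinberg structure: `H ∈ Sym²(A)` and `[H, H] = 0`. -/
def IsKoszulVinberg (H : A.Cochain 1) : Prop :=
  H ∈ A.Sym2 ∧ ∀ α₁ α₂ α₃, A.kv H H α₁ α₂ α₃ = 0

/-! ### Cohomology of a Koszul–Vinberg structure -/

/-- The coboundary `δφ = (-1)^{k-1} ⟦H, φ⟧` of a cochain `φ` of degree `k` (index `k - 1`), as a
function on tuples of sections. -/
def deltaFun (H : A.Cochain 1) {k : ℕ} (φ : A.Cochain k) : (Fin (k + 1) → A.Dual) → A.Sec :=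
  fun u => (-1 : ℤ) ^ k • A.bracket H φ u

theorem dualL_add (x y : A.Sec) (ξ : A.Dual) : A.dualL (x + y) ξ = A.dualL x ξ + A.dualL y ξ := by
  ext1 z
  simp only [dualL_apply, LinearMap.add_apply, act, anchorAct_add_left, map_add]
  abel

theorem dualL_smul (r : ℝ) (x : A.Sec) (ξ : A.Dual) : A.dualL (r • x) ξ = r • A.dualL x ξ := by
  ext1 z
  simp only [dualL_apply, LinearMap.smul_apply, act, anchorAct_smul_left, map_smul,
    LinearMap.map_smul_of_tower, smul_sub]

theorem sharp_add (H : A.Cochain 1) (α β : A.Dual) :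
    A.sharp H (α + β) = A.sharp H α + A.sharp H β :=
  H.map_vecCons_add ![] α β

theorem sharp_smul (H : A.Cochain 1) (r : ℝ) (α : A.Dual) :
    A.sharp H (r • α) = r • A.sharp H α := by
  have h := H.map_vecCons_smul ![] (algebraMap ℝ A.Fn r) α
  simpa only [algebraMap_smul, sharp] using h

theorem insertion_left (H : A.Cochain 1) {q : ℕ} (Q : (Fin q → A.Dual) → A.Sec)
    (u : Fin (q + 1) → A.Dual) :
    A.insertion H Q u = ∑ σ ∈ unshuffles₃ q 1, (Equiv.Perm.sign σ : ℤ) •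
      A.sharp H (A.dualL (Q fun j => u (σ (Fin.castAdd 1 j))) (u (σ (Fin.natAdd q 0)))) := by
  unfold insertion sharp
  refine Finset.sum_congr rfl fun σ _ => ?_
  congr 2
  funext i
  obtain rfl : i = 0 := Subsingleton.elim _ _
  rfl

theorem deltaFun_add (H : A.Cochain 1) {k : ℕ} (φ ψ : A.Cochain k) :
    A.deltaFun H (φ + ψ) = A.deltaFun H φ + A.deltaFun H ψ := by
  funext u
  simp only [deltaFun, Pi.add_apply, bracket, insertion_left]
  simp only [insertion, lie, AlternatingMap.add_apply, dualL_add, sharp_add, map_add,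
    LinearMap.add_apply, smul_add, smul_sub, Finset.sum_add_distrib, Finset.sum_sub_distrib]
  abel

theorem deltaFun_smul (H : A.Cochain 1) {k : ℕ} (r : ℝ) (φ : A.Cochain k) :
    A.deltaFun H (r • φ) = r • A.deltaFun H φ := by
  funext u
  simp only [deltaFun, Pi.smul_apply, bracket, insertion_left]
  simp only [insertion, lie, AlternatingMap.smul_apply, dualL_smul, sharp_smul, map_smul,
    LinearMap.smul_apply, ← smul_sub, smul_comm _ r, ← Finset.smul_sum, ← smul_add]

theorem dualR_add (x y : A.Sec) (ξ : A.Dual) : A.dualR (x + y) ξ = A.dualR x ξ + A.dualR y ξ := by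
  ext1 z
  change -ξ (A.mul z (x + y)) = -ξ (A.mul z x) + -ξ (A.mul z y)
  rw [map_add, map_add, neg_add]

theorem dualR_smul (r : ℝ) (x : A.Sec) (ξ : A.Dual) : A.dualR (r • x) ξ = r • A.dualR x ξ := by
  ext1 z
  change -ξ (A.mul z (r • x)) = r • -ξ (A.mul z x)
  rw [map_smul, LinearMap.map_smul_of_tower, smul_neg]

/-- The coboundary operator `δ`, as a real linear map. -/
def delta (H : A.Cochain 1) (k : ℕ) : A.Cochain k →ₗ[ℝ] ((Fin (k + 1) → A.Dual) → A.Sec) where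
  toFun φ := A.deltaFun H φ
  map_add' φ ψ := A.deltaFun_add H φ ψ
  map_smul' r φ := A.deltaFun_smul H r φ

/-- The inclusion of the cochains into all functions on tuples of sections. -/
def toFunₗ (k : ℕ) : A.Cochain k →ₗ[ℝ] ((Fin k → A.Dual) → A.Sec) where
  toFun φ := φ
  map_add' _ _ := rfl
  map_smul' _ _ := rfl

/-- The sections `x` with `H(R_x α₁, α₂) = H(α₁, R_x α₂)`. -/
def tilde₁ (H : A.Cochain 1) : Submodule ℝ (A.Cochain 0) where
  carrier := {x | ∀ α₁ α₂, A.eval₂ H (A.dualR (x ![]) α₁) α₂ = A.eval₂ H α₁ (A.dualR (x ![]) α₂)}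
  add_mem' {x y} hx hy α₁ α₂ := by
    have h := congrArg₂ (· + ·) (hx α₁ α₂) (hy α₁ α₂)
    simpa only [eval₂, AlternatingMap.add_apply, dualR_add, sharp_add, map_add,
      LinearMap.add_apply] using h
  zero_mem' α₁ α₂ := by
    have h0 : ∀ ξ : A.Dual, A.dualR 0 ξ = 0 := fun ξ => by simpa using A.dualR_smul 0 0 ξ
    have h1 : A.sharp H 0 = 0 := by simpa using A.sharp_smul H 0 0
    simp [eval₂, h0, h1]
  smul_mem' r x hx α₁ α₂ := by
    have h := congrArg (r • ·) (hx α₁ α₂)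
    simpa only [eval₂, AlternatingMap.smul_apply, dualR_smul, sharp_smul,
      LinearMap.map_smul_of_tower, LinearMap.smul_apply] using h

/-- The `φ` of degree `3` with `φ(α₁, α₂, α₃) + φ(α₂, α₃, α₁) + φ(α₃, α₁, α₂) = 0`. -/
def tilde₃ : Submodule ℝ (A.Cochain 2) where
  carrier := {φ | ∀ α₁ α₂ α₃ : A.Dual, α₃ (φ ![α₁, α₂]) + α₁ (φ ![α₂, α₃]) + α₂ (φ ![α₃, α₁]) = 0}
  add_mem' {φ ψ} hφ hψ α₁ α₂ α₃ := by
    have h := congrArg₂ (· + ·) (hφ α₁ α₂ α₃) (hψ α₁ α₂ α₃)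
    simp only [AlternatingMap.add_apply, map_add, add_zero] at h ⊢
    rw [← h]
    abel
  zero_mem' α₁ α₂ α₃ := by simp
  smul_mem' r φ hφ α₁ α₂ α₃ := by
    have h := congrArg (r • ·) (hφ α₁ α₂ α₃)
    simpa only [AlternatingMap.smul_apply, LinearMap.map_smul_of_tower, smul_add, smul_zero] using h

/-- The cochains `C̃_KV^{k+1}(A^*)` of the subcomplex `C̃_KV`. -/
def Tilde (H : A.Cochain 1) : (k : ℕ) → Submodule ℝ (A.Cochain k)
  | 0 => A.tilde₁ H
  | 1 => A.Sym2
  | 2 => A.tilde₃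
  | _ + 3 => ⊤

/-- The cocycles of `C̃_KV^{k+1}(A^*)`. -/
def TildeCocycle (H : A.Cochain 1) (k : ℕ) : Submodule ℝ (A.Cochain k) :=
  A.Tilde H k ⊓ LinearMap.ker (A.delta H k)

/-- The coboundaries `δ(C̃_KV^{k+1}(A^*))`, as cochains of degree `k + 2`. -/
def TildeCoboundary (H : A.Cochain 1) (k : ℕ) : Submodule ℝ (A.Cochain (k + 1)) :=
  ((A.Tilde H k).map (A.delta H k)).comap (A.toFunₗ (k + 1))

/-- The cohomology group `H̃_KV^{k+2}(A^*)`: cocycles modulo coboundaries. -/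
abbrev TildeCohomology (H : A.Cochain 1) (k : ℕ) :=
  A.TildeCocycle H (k + 1) ⧸ (A.TildeCoboundary H k).submoduleOf (A.TildeCocycle H (k + 1))

/-! ### Deformations -/

/-- The order `N` deformations `∑_{i ≤ N} H_i t^i` of `H`: the coefficients `H_i` lie in `Sym²(A)`,
`H_0 = H`, and `[∑ H_i t^i, ∑ H_i t^i] = 0` modulo `t^{N+1}`, where the operations of `A` are
extended linearly in `t`. -/
def OrderDeformation (H : A.Cochain 1) (N : ℕ) :=
  {h : ℕ → A.Cochain 1 // h 0 = H ∧ (∀ i, h i ∈ A.Sym2) ∧ (∀ i, N < i → h i = 0) ∧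
    ∀ k ≤ N, ∀ α₁ α₂ α₃, ∑ ij ∈ Finset.HasAntidiagonal.antidiagonal k, A.kv (h ij.1) (h ij.2) α₁ α₂ α₃ = 0}

/-- Infinitesimal deformations are deformations of order one. -/
abbrev InfinitesimalDeformation (H : A.Cochain 1) := A.OrderDeformation H 1

/-- `ad_X T = ⟦X, T⟧` for formal power series `X = ∑ X_i t^i` and `T = ∑ T_i t^i` with `X_i` of
degree `0` (sections of `A`) and `T_i` of degree `1` in the graded Lie algebra. -/
def adSeries (X : ℕ → A.Cochain 0) (T : ℕ → (Fin 1 → A.Dual) → A.Sec) :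
    ℕ → (Fin 1 → A.Dual) → A.Sec :=
  fun k => ∑ ij ∈ Finset.HasAntidiagonal.antidiagonal k, A.bracket (X ij.1) (T ij.2)

/-- `exp(ad_X) T = ∑_m (1/m!) ad_X^m T` for a series `X` without constant term; then the terms with
`m > k` do not contribute to the coefficient of `t^k`. -/
def expAd (X : ℕ → A.Cochain 0) (T : ℕ → (Fin 1 → A.Dual) → A.Sec) :
    ℕ → (Fin 1 → A.Dual) → A.Sec :=
  fun k => ∑ m ∈ Finset.range (k + 1), ((m.factorial : ℝ)⁻¹) • ((A.adSeries X)^[m] T) k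

/-- Order `N` deformations `h`, `h'` are equivalent if `exp(ad_X) h = h'` modulo `t^{N+1}` for some
formal series `X = ∑_{i ≥ 1} X_i t^i` of sections of `A`. -/
def DeformationEquiv (H : A.Cochain 1) (N : ℕ) (h h' : A.OrderDeformation H N) : Prop :=
  ∃ X : ℕ → A.Cochain 0, X 0 = 0 ∧
    ∀ k ≤ N, A.expAd X (fun i => ⇑(h.1 i)) k = ⇑(h'.1 k)

end LeftSymmetricAlgebroid

end KoszulVinberg

end

/-! Modulo `t²` only `x₁` acts in `exp(ad_X)`, so `H + tH₁` becomes `H + t(H₁ - δx₁)`, while the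
coefficient of `t` in `[H + tH₁, H + tH₁]` is the polarization of the Koszul–Vinberg expression. Two
facts turn this into cohomology.

For symmetric `H` and `K`, pairing the graded bracket `⟦H, K⟧` with `γ` gives exactly that
polarization (`dual_bracketOne`). Sections are separated by the dual module
(`section_eq_zero_of_dual`), so infinitesimal deformations correspond to symmetric cocycles.

For a section `x`, the skew part of `δx` is the defect of the condition defining `C̃¹`
(`deltaSec_mem_Sym2_iff`). Any `x₁` that relates two deformations therefore lies in `C̃¹`
automatically, and equivalence means differing by an element of `δ(C̃¹)`.

The identity `δ² = 0` on sections is checked by hand (`bracketOne_deltaSec`): it uses that `L`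
represents the sub-adjacent Lie algebra on `Γ(A^*)`, which rests on `act_lie_dual`. -/

noncomputable section
namespace KoszulVinberg

/-! ### Separation of sections by the dual module -/

section Separation

variable {n : ℕ} {M : Type*} [TopologicalSpace M] [T2Space M]
  [ChartedSpace (EuclideanSpace ℝ (Fin n)) M] [IsManifold (𝓡 n) ∞ M]
  {F : Type*} [NormedAddCommGroup F] [NormedSpace ℝ F]
  {V : M → Type*} [TopologicalSpace (Bundle.TotalSpace F V)]
  [∀ p, TopologicalSpace (V p)] [FiberBundle F V]
  [∀ p, AddCommGroup (V p)] [∀ p, Module ℝ (V p)] [VectorBundle ℝ F V]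
  [ContMDiffVectorBundle ∞ F V (𝓡 n)]

/-- A functional on the fibre, extended by means of the trivialization at `p` and multiplied by a
bump function supported in the base set of that trivialization. -/
def bumpDual (p : M) (ρ : SmoothBumpFunction (𝓡 n) p)
    (hρ : tsupport ρ ⊆ (trivializationAt F V p).baseSet) (l : F →L[ℝ] ℝ) :
    Module.Dual C^∞⟮𝓡 n, M; ℝ⟯ Cₛ^∞⟮𝓡 n; F, V⟯ where
  toFun s := ⟨fun q => ρ q * l ((trivializationAt F V p).continuousLinearMapAt ℝ q (s q)), by
    intro q
    -- The trivialization is controlled only over its base set; off the closed support of `ρ` the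
    -- product is locally zero.
    by_cases hq : q ∈ tsupport ρ
    · refine ρ.contMDiffAt.mul ?_
      have hb := hρ hq
      have h1 := ((trivializationAt F V p).contMDiffAt_section_iff
        (IB := 𝓡 n) (n := ∞) (s := s) hb).1 s.contMDiff.contMDiffAt
      have h2 := l.contMDiff.contMDiffAt.comp q h1
      refine h2.congr_of_eventuallyEq ?_
      filter_upwards [(trivializationAt F V p).open_baseSet.mem_nhds hb] with r hr
      simp [Bundle.Trivialization.coe_linearMapAt_of_mem _ hr]
    · refine (contMDiffAt_const (c := (0 : ℝ))).congr_of_eventuallyEq ?_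
      filter_upwards [(isClosed_tsupport ρ).isOpen_compl.mem_nhds hq] with r hr
      simp [image_eq_zero_of_notMem_tsupport hr]⟩
  map_add' s t := by
    ext q
    change ρ q * l ((trivializationAt F V p).continuousLinearMapAt ℝ q (s q + t q))
      = ρ q * l ((trivializationAt F V p).continuousLinearMapAt ℝ q (s q))
        + ρ q * l ((trivializationAt F V p).continuousLinearMapAt ℝ q (t q))
    rw [map_add, map_add, mul_add]
  map_smul' f s := by
    ext q
    change ρ q * l ((trivializationAt F V p).continuousLinearMapAt ℝ q (f q • s q))
      = f q * (ρ q * l ((trivializationAt F V p).continuousLinearMapAt ℝ q (s q)))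
    rw [map_smul, map_smul, smul_eq_mul, mul_left_comm]

/-- Elements of the dual act on global sections, so a functional on the fibre at `p` must first be
globalized by a bump function equal to `1` at `p`. Functionals on `F` then separate the fibre
values. -/
theorem section_eq_zero_of_dual (s : Cₛ^∞⟮𝓡 n; F, V⟯)
    (h : ∀ α : Module.Dual C^∞⟮𝓡 n, M; ℝ⟯ Cₛ^∞⟮𝓡 n; F, V⟯, α s = 0) : s = 0 := by
  ext p
  have hb : p ∈ (trivializationAt F V p).baseSet := FiberBundle.mem_baseSet_trivializationAt' p
  obtain ⟨ρ, -, hρ⟩ := (SmoothBumpFunction.nhds_basis_tsupport (I := 𝓡 n) p).mem_iff.1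
    ((trivializationAt F V p).open_baseSet.mem_nhds hb)
  have h0 : (trivializationAt F V p).continuousLinearMapAt ℝ p (s p) = 0 := by
    refine SeparatingDual.eq_zero_of_forall_dual_eq_zero (R := ℝ) fun l => ?_
    have h2 := congrArg (fun f : C^∞⟮𝓡 n, M; ℝ⟯ => f p) (h (bumpDual p ρ hρ l))
    change ρ p * l ((trivializationAt F V p).continuousLinearMapAt ℝ p (s p)) = 0 at h2
    rwa [ρ.eq_one, one_mul] at h2
  have h3 := (trivializationAt F V p).symmL_continuousLinearMapAt (R := ℝ) hb (s p)
  rw [← h3, h0, map_zero]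
  rfl

end Separation

namespace LeftSymmetricAlgebroid

variable {n : ℕ} {M : Type*} [TopologicalSpace M] [ChartedSpace (EuclideanSpace ℝ (Fin n)) M]
  [IsManifold (𝓡 n) ∞ M]
  {F : Type*} [NormedAddCommGroup F] [NormedSpace ℝ F]
  {V : M → Type*} [TopologicalSpace (Bundle.TotalSpace F V)]
  [∀ p, TopologicalSpace (V p)] [FiberBundle F V]
  [∀ p, AddCommGroup (V p)] [∀ p, Module ℝ (V p)] [VectorBundle ℝ F V]
  (A : LeftSymmetricAlgebroid n M F V)

/-! ### The bracket in low degrees -/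

theorem unshuffles₃_zero_right (q : ℕ) : unshuffles₃ q 0 = ∅ := by
  simp [unshuffles₃]

/-- All blocks have at most one element, so the monotonicity conditions are vacuous. -/
theorem unshuffles₃_one_right {q : ℕ} (hq : q ≤ 1) : unshuffles₃ q 1 = Finset.univ := by
  ext σ
  simp only [unshuffles₃, Finset.mem_filter, Finset.mem_univ, true_and, iff_true]
  refine ⟨one_pos, fun i j h1 h2 h3 => ?_, fun i j h1 h2 h3 => ?_⟩ <;>
    · rw [Fin.lt_def] at h2
      omega

theorem unshuffles₂_eq_univ {p q : ℕ} (hp : p ≤ 1) (hq : q ≤ 1) :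
    unshuffles₂ p q = Finset.univ := by
  ext σ
  simp only [unshuffles₂, Finset.mem_filter, Finset.mem_univ, true_and, iff_true]
  refine ⟨fun i j h1 h2 h3 => ?_, fun i j h1 h2 h3 => ?_⟩ <;>
    · rw [Fin.lt_def] at h2
      omega

theorem sum_perm_fin_one {N : Type*} [AddCommGroup N] (f : Equiv.Perm (Fin 1) → N) :
    ∑ σ, f σ = f 1 :=
  Fintype.sum_subsingleton f 1

theorem sum_perm_fin_two {N : Type*} [AddCommGroup N] (f : Equiv.Perm (Fin 2) → N) :
    ∑ σ, f σ = f 1 + f (Equiv.swap 0 1) := by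
  have h : (Finset.univ : Finset (Equiv.Perm (Fin 2))) = {1, Equiv.swap 0 1} := by decide
  rw [h, Finset.sum_pair (by decide)]

theorem cochain_apply_fin_one (H : A.Cochain 1) (u : Fin 1 → A.Dual) : H u = A.sharp H (u 0) := by
  unfold sharp
  congr 1
  funext i
  obtain rfl : i = 0 := Subsingleton.elim _ _
  rfl

theorem cochain_apply_fin_zero (x : A.Cochain 0) (u : Fin 0 → A.Dual) : x u = x ![] := by
  congr 1
  exact Subsingleton.elim _ _

theorem insertion_zero_right (H : A.Cochain 1) (x : A.Cochain 0) (u : Fin 1 → A.Dual) :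
    A.insertion H x u = A.sharp H (A.dualL (x ![]) (u 0)) := by
  rw [insertion_left, unshuffles₃_one_right zero_le_one]
  -- The index type is `Fin (0 + 1)`, which agrees with `Fin 1` only by unfolding.
  erw [sum_perm_fin_one]
  rw [cochain_apply_fin_zero]
  simp

theorem insertion_zero_left (H : A.Cochain 1) (x : A.Cochain 0) (u : Fin (1 + 0) → A.Dual) :
    A.insertion x H u = 0 := by
  rw [insertion, unshuffles₃_zero_right, Finset.sum_empty]

theorem insertion_one_one (H K : A.Cochain 1) (u : Fin 2 → A.Dual) :
    A.insertion H K u = A.sharp H (A.dualL (A.sharp K (u 0)) (u 1))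
      - A.sharp H (A.dualL (A.sharp K (u 1)) (u 0)) := by
  rw [insertion_left, unshuffles₃_one_right le_rfl]
  erw [sum_perm_fin_two]
  simp only [cochain_apply_fin_one]
  simp [sub_eq_add_neg]

theorem bracket_one_zero (H : A.Cochain 1) (x : A.Cochain 0) (u : Fin 1 → A.Dual) :
    A.bracket H x u
      = A.sharp H (A.dualL (x ![]) (u 0)) + A.lie (A.sharp H (u 0)) (x ![]) := by
  rw [bracket, insertion_zero_left, insertion_zero_right, unshuffles₂_eq_univ le_rfl zero_le_one]
  erw [sum_perm_fin_one]
  simp only [cochain_apply_fin_one, cochain_apply_fin_zero]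
  simp

/-- The opposite of `bracket_one_zero`, as graded skew symmetry predicts; this sign makes `ad_x H`
equal to `-δx`. -/
theorem bracket_zero_one (H : A.Cochain 1) (x : A.Cochain 0) (u : Fin 1 → A.Dual) :
    A.bracket x H u
      = -(A.sharp H (A.dualL (x ![]) (u 0)) + A.lie (A.sharp H (u 0)) (x ![])) := by
  have h1 := A.insertion_zero_left H x u
  have h2 := A.insertion_zero_right H x u
  rw [bracket, unshuffles₂_eq_univ zero_le_one le_rfl]
  erw [h1, h2, sum_perm_fin_one]
  simp only [cochain_apply_fin_one, cochain_apply_fin_zero]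
  simp [lie]
  abel

theorem bracket_one_one (H K : A.Cochain 1) (u : Fin 2 → A.Dual) :
    A.bracket H K u
      = A.sharp H (A.dualL (A.sharp K (u 0)) (u 1)) - A.sharp H (A.dualL (A.sharp K (u 1)) (u 0))
      + (A.sharp K (A.dualL (A.sharp H (u 0)) (u 1)) - A.sharp K (A.dualL (A.sharp H (u 1)) (u 0)))
      - (A.lie (A.sharp H (u 0)) (A.sharp K (u 1)) - A.lie (A.sharp H (u 1)) (A.sharp K (u 0))) := by
  have h1 := A.insertion_one_one H K u
  have h2 := A.insertion_one_one K H u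
  rw [bracket, unshuffles₂_eq_univ le_rfl le_rfl]
  erw [h1, h2, sum_perm_fin_two]
  simp only [cochain_apply_fin_one]
  simp [sub_eq_add_neg]
  abel

/-! ### The sub-adjacent Lie algebroid and its representation on the dual -/

theorem act_sub (x : A.Sec) (f g : A.Fn) : A.act x (f - g) = A.act x f - A.act x g := by
  rw [eq_sub_iff_add_eq, act, act, act, ← anchorAct_add, sub_add_cancel]

theorem act_zero (x : A.Sec) : A.act x 0 = 0 := by
  simpa using A.act_sub x 0 0

theorem act_mul (x : A.Sec) (f g : A.Fn) : A.act x (f * g) = f * A.act x g + A.act x f * g :=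
  anchorAct_mul _ _ _ _

theorem act_smul_left (g : A.Fn) (x : A.Sec) (f : A.Fn) : A.act (g • x) f = g * A.act x f := by
  ext p
  change (mfderiv (𝓡 n) 𝓘(ℝ, ℝ) f p (A.anchor p (g p • x p)) : ℝ)
    = (g p • (mfderiv (𝓡 n) 𝓘(ℝ, ℝ) f p (A.anchor p (x p)) : ℝ) : ℝ)
  rw [map_smul, map_smul]

/-- Left symmetry of the associator, rearranged: left multiplication represents the commutator. -/
theorem lie_mul (x y z : A.Sec) :
    A.mul (A.lie x y) z = A.mul x (A.mul y z) - A.mul y (A.mul x z) := by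
  have h := A.left_symm x y z
  rw [lie, map_sub, LinearMap.sub_apply]
  linear_combination (norm := module) -h

theorem lie_lie (x y z : A.Sec) :
    A.lie (A.lie x y) z = A.lie x (A.lie y z) - A.lie y (A.lie x z) := by
  have h1 := A.lie_mul x y z
  have h2 := A.lie_mul x z y
  have h3 := A.lie_mul y z x
  simp only [lie, map_sub, LinearMap.sub_apply] at *
  linear_combination (norm := module) h1 - h2 + h3

theorem lie_skew (x y : A.Sec) : A.lie x y = -A.lie y x := by
  simp only [lie, neg_sub]

theorem lie_add_right (x y z : A.Sec) : A.lie x (y + z) = A.lie x y + A.lie x z := by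
  simp only [lie, map_add, LinearMap.add_apply]
  abel

theorem lie_sub_right (x y z : A.Sec) : A.lie x (y - z) = A.lie x y - A.lie x z := by
  simp only [lie, map_sub, LinearMap.sub_apply]
  abel

theorem lie_smul_right (f : A.Fn) (x y : A.Sec) :
    A.lie x (f • y) = f • A.lie x y + A.act x f • y := by
  simp only [lie, A.mul_smul_right, A.mul_smul_left, smul_sub, act]
  abel

/-- Expanding `[x, y] ∗ (f z)` by the Leibniz rule and by `lie_mul` leaves only the failure of the
anchor to preserve brackets. -/
theorem smul_act_lie_sub (x y z : A.Sec) (f : A.Fn) :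
    (A.act (A.lie x y) f - (A.act x (A.act y f) - A.act y (A.act x f))) • z = 0 := by
  have h := A.lie_mul x y (f • z)
  simp only [A.mul_smul_right, map_add, A.lie_mul] at h
  simp only [act]
  linear_combination (norm := module) h

/-- The anchor is a morphism of Lie algebras on the functions that are values of the pairing. If
the fibres do not vanish, this holds on all functions. -/
theorem act_lie_dual (x y z : A.Sec) (ξ : A.Dual) :
    A.act (A.lie x y) (ξ z) = A.act x (A.act y (ξ z)) - A.act y (A.act x (ξ z)) := by
  -- The defect `D` is a derivation. With `f = ξ z`, applying `ξ` to the previous lemma gives `D f *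
  -- f = 0`; applying `D` to this and eliminating `D (D f)` gives `(D f)³ = 0`, and real-valued
  -- functions have no nilpotents.
  let D : A.Fn → A.Fn := fun f => A.act (A.lie x y) f - (A.act x (A.act y f) - A.act y (A.act x f))
  have hadd : ∀ x f g, A.act x (f + g) = A.act x f + A.act x g := fun x => anchorAct_add _ x
  have hD : ∀ f g, D (f * g) = f * D g + D f * g := fun f g => by
    simp only [D, act_mul, hadd]
    ring
  have h1 : D (ξ z) * ξ z = 0 := by
    rw [← smul_eq_mul, ← map_smul, smul_act_lie_sub, map_zero]
  have h2 : D (D (ξ z)) * ξ z + D (ξ z) * D (ξ z) = 0 := by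
    have h := hD (D (ξ z)) (ξ z)
    rw [h1] at h
    have h0 : D 0 = 0 := by simp [D, act_zero]
    rw [h0] at h
    linear_combination -h
  have h3 : D (ξ z) * D (ξ z) * D (ξ z) = 0 := by
    linear_combination D (ξ z) * h2 - D (D (ξ z)) * h1
  have h4 : D (ξ z) = 0 := by
    ext p
    have h := congrArg (fun f : C^∞⟮𝓡 n, M; ℝ⟯ => f p) h3
    change D (ξ z) p * D (ξ z) p * D (ξ z) p = 0 at h
    change D (ξ z) p = 0
    simpa using h
  exact sub_eq_zero.1 h4

theorem dualL_add_right (x : A.Sec) (ξ η : A.Dual) :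
    A.dualL x (ξ + η) = A.dualL x ξ + A.dualL x η := by
  ext1 z
  simp only [dualL_apply, LinearMap.add_apply, act, anchorAct_add]
  abel

theorem dualL_smul_right (x : A.Sec) (f : A.Fn) (ξ : A.Dual) :
    A.dualL x (f • ξ) = f • A.dualL x ξ + A.act x f • ξ := by
  ext1 z
  simp only [dualL_apply, LinearMap.add_apply, LinearMap.smul_apply, smul_eq_mul, act_mul]
  ring

theorem dualL_smul_left (f : A.Fn) (x : A.Sec) (ξ : A.Dual) :
    A.dualL (f • x) ξ = f • A.dualL x ξ := by
  ext1 z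
  simp only [dualL_apply, LinearMap.smul_apply, smul_eq_mul, act_smul_left, A.mul_smul_left,
    map_smul]
  ring

theorem dualL_lie (x y : A.Sec) (ξ : A.Dual) :
    A.dualL (A.lie x y) ξ = A.dualL x (A.dualL y ξ) - A.dualL y (A.dualL x ξ) := by
  ext1 z
  simp only [dualL_apply, LinearMap.sub_apply, act_lie_dual, lie_mul, map_sub, act_sub]
  ring

theorem sharp_smul_fn (H : A.Cochain 1) (f : A.Fn) (α : A.Dual) :
    A.sharp H (f • α) = f • A.sharp H α :=
  H.map_vecCons_smul ![] f α

theorem sharp_sub (H : A.Cochain 1) (α β : A.Dual) :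
    A.sharp H (α - β) = A.sharp H α - A.sharp H β := by
  rw [eq_sub_iff_add_eq, ← sharp_add, sub_add_cancel]

/-! ### The coboundary in low degrees -/

/-- `δx` for a section `x` of `A`, as a cochain. -/
def deltaSec (H : A.Cochain 1) (x : A.Sec) : A.Cochain 1 :=
  AlternatingMap.ofSubsingleton A.Fn A.Dual A.Sec (0 : Fin 1)
    { toFun := fun α => A.sharp H (A.dualL x α) + A.lie (A.sharp H α) x
      map_add' := fun α β => by
        simp only [dualL_add_right, sharp_add, lie_skew A _ x, lie_add_right]
        abel
      map_smul' := fun f α => by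
        -- The derivative of `f` along `x` enters once from `L_x` and once, with opposite sign, from
        -- the bracket.
        simp only [dualL_smul_right, sharp_add, sharp_smul_fn, lie_skew A _ x, lie_smul_right,
          RingHom.id_apply]
        module }

theorem sharp_deltaSec (H : A.Cochain 1) (x : A.Sec) (α : A.Dual) :
    A.sharp (A.deltaSec H x) α = A.sharp H (A.dualL x α) + A.lie (A.sharp H α) x := rfl

theorem coe_deltaSec (H : A.Cochain 1) (x : A.Cochain 0) :
    ⇑(A.deltaSec H (x ![])) = A.delta H 0 x := by
  funext u
  change _ = A.deltaFun H x u
  rw [deltaFun, bracket_one_zero, cochain_apply_fin_one, sharp_deltaSec, pow_zero, one_smul]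

/-- The value of the bracket of two cochains of index `1`. -/
def bracketOne (H K : A.Cochain 1) (α β : A.Dual) : A.Sec :=
  A.sharp H (A.dualL (A.sharp K α) β) - A.sharp H (A.dualL (A.sharp K β) α)
    + (A.sharp K (A.dualL (A.sharp H α) β) - A.sharp K (A.dualL (A.sharp H β) α))
    - (A.lie (A.sharp H α) (A.sharp K β) - A.lie (A.sharp H β) (A.sharp K α))

theorem bracketOne_skew (H K : A.Cochain 1) (α β : A.Dual) :
    A.bracketOne H K α β = -A.bracketOne H K β α := by
  unfold bracketOne
  abel

theorem bracketOne_self (H K : A.Cochain 1) (α : A.Dual) : A.bracketOne H K α α = 0 := by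
  unfold bracketOne
  abel

theorem bracketOne_add_right (H K : A.Cochain 1) (α β γ : A.Dual) :
    A.bracketOne H K α (β + γ) = A.bracketOne H K α β + A.bracketOne H K α γ := by
  simp only [bracketOne, dualL_add_right, sharp_add, dualL_add, lie_skew A (_ + _), lie_add_right,
    lie_skew A (A.sharp H β), lie_skew A (A.sharp H γ)]
  abel

/-- The four derivatives of `f`, two along `H^♯ α` and two along `K^♯ α`, cancel in pairs between
the `L` terms and the Lie brackets. -/
theorem bracketOne_smul_right (H K : A.Cochain 1) (f : A.Fn) (α β : A.Dual) :
    A.bracketOne H K α (f • β) = f • A.bracketOne H K α β := by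
  simp only [bracketOne, dualL_smul_right, sharp_add, sharp_smul_fn, dualL_smul_left,
    lie_skew A (f • _), lie_smul_right, lie_skew A (A.sharp H β)]
  module

/-- The bracket of two cochains of index `1`, as a cochain. -/
def bracketCochain (H K : A.Cochain 1) : A.Cochain 2 where
  toFun u := A.bracketOne H K (u 0) (u 1)
  map_update_add' u i x y := by
    obtain rfl | rfl : i = 0 ∨ i = 1 := by omega
    · simp [bracketOne_skew A H K _ (u 1), bracketOne_add_right, add_comm]
    · simp [bracketOne_add_right]
  map_update_smul' u i f x := by
    obtain rfl | rfl : i = 0 ∨ i = 1 := by omega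
    · simp [bracketOne_skew A H K _ (u 1), bracketOne_smul_right]
    · simp [bracketOne_smul_right]
  map_eq_zero_of_eq' u i j h hij := by
    have h01 : u 0 = u 1 := by
      obtain ⟨rfl, rfl⟩ | ⟨rfl, rfl⟩ : (i = 0 ∧ j = 1) ∨ (i = 1 ∧ j = 0) := by omega
      exacts [h, h.symm]
    rw [h01, bracketOne_self]

theorem delta_one_apply (H K : A.Cochain 1) (u : Fin 2 → A.Dual) :
    A.delta H 1 K u = -A.bracketOne H K (u 0) (u 1) := by
  change A.deltaFun H K u = _
  rw [deltaFun, bracket_one_one, pow_one, neg_smul, one_smul]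
  rfl

theorem coe_neg_bracketCochain (H K : A.Cochain 1) :
    ⇑(-A.bracketCochain H K) = A.delta H 1 K := by
  funext u
  rw [delta_one_apply]
  rfl

theorem delta_one_eq_zero_iff (H K : A.Cochain 1) :
    A.delta H 1 K = 0 ↔ ∀ α β, A.bracketOne H K α β = 0 := by
  refine ⟨fun h α β => ?_, fun h => ?_⟩
  · have h' := congrFun h ![α, β]
    rw [delta_one_apply] at h'
    exact neg_eq_zero.1 h'
  · funext u
    rw [delta_one_apply, h, neg_zero]
    rfl

/-! ### The bracket and the Koszul–Vinberg expression -/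

theorem sharp_symm {H : A.Cochain 1} (hH : H ∈ A.Sym2) (α β : A.Dual) :
    β (A.sharp H α) = α (A.sharp H β) := hH α β

/-- Symmetry moves each `L_x` out of the argument of `sharp`, where its definition produces the
anchor and product terms of `kv`. -/
theorem dual_bracketOne {H K : A.Cochain 1} (hH : H ∈ A.Sym2) (hK : K ∈ A.Sym2)
    (α β γ : A.Dual) :
    γ (A.bracketOne H K α β) = A.kv H K α β γ + A.kv K H α β γ := by
  simp only [bracketOne, kv, map_sub, map_add, A.sharp_symm hH (A.dualL _ _),
    A.sharp_symm hK (A.dualL _ _), dualL_apply, A.sharp_symm hH γ β, A.sharp_symm hH γ α,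
    A.sharp_symm hK γ β, A.sharp_symm hK γ α, lie]
  ring

/-- In the cyclic sum the anchor terms cancel within each of `kv H K` and `kv K H`; some product
terms cancel only between the two. -/
theorem dual_bracketOne_cyclic {H K : A.Cochain 1} (hH : H ∈ A.Sym2) (hK : K ∈ A.Sym2)
    (α β γ : A.Dual) :
    γ (A.bracketOne H K α β) + α (A.bracketOne H K β γ) + β (A.bracketOne H K γ α) = 0 := by
  simp only [A.dual_bracketOne hH hK]
  simp only [kv, lie, map_sub, A.sharp_symm hH β α, A.sharp_symm hH γ α, A.sharp_symm hH γ β,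
    A.sharp_symm hK β α, A.sharp_symm hK γ α, A.sharp_symm hK γ β]
  ring

theorem bracketCochain_mem_tilde₃ {H K : A.Cochain 1} (hH : H ∈ A.Sym2) (hK : K ∈ A.Sym2) :
    A.bracketCochain H K ∈ A.tilde₃ := fun α β γ => A.dual_bracketOne_cyclic hH hK α β γ

/-- A section is in `C̃¹` if and only if its coboundary is symmetric. -/
theorem deltaSec_mem_Sym2_iff {H : A.Cochain 1} (hH : H ∈ A.Sym2) (x : A.Cochain 0) :
    A.deltaSec H (x ![]) ∈ A.Sym2 ↔ x ∈ A.tilde₁ H := by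
  refine forall₂_congr fun α β => ?_
  have h1 : A.eval₂ H (A.dualR (x ![]) α) β = -α (A.mul (A.sharp H β) (x ![])) :=
    A.sharp_symm hH _ _
  have h2 : A.eval₂ H α (A.dualR (x ![]) β) = -β (A.mul (A.sharp H α) (x ![])) := rfl
  rw [h1, h2]
  -- The terms containing `a(x)` or left multiplication by `x` are jointly symmetric in `α` and `β`;
  -- only right multiplication by `x` contributes to the skew part.
  simp only [eval₂, sharp_deltaSec, map_add, lie, map_sub, A.sharp_symm hH (A.dualL _ _),
    dualL_apply, A.sharp_symm hH β α]
  constructor <;> intro h <;> linear_combination h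

/-- The hypothesis says that `H^♯` sends `L_{H^♯ α} β - L_{H^♯ β} α` to `[H^♯ α, H^♯ β]`.
Differentiate this identity along `x`, by `L_x` on the arguments and `[x, ·]` on the value;
`dualL_lie` and Jacobi identify the result with the claim. -/
theorem bracketOne_deltaSec (H : A.Cochain 1) (x : A.Sec) (hB : ∀ α β, A.bracketOne H H α β = 0)
    (α β : A.Dual) : A.bracketOne H (A.deltaSec H x) α β = 0 := by
  have hB' : ∀ α β, A.sharp H (A.dualL (A.sharp H α) β) - A.sharp H (A.dualL (A.sharp H β) α)
      - A.lie (A.sharp H α) (A.sharp H β) = 0 := fun α β => by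
    have h := hB α β
    rw [bracketOne, A.lie_skew (A.sharp H β)] at h
    -- On the diagonal each term of the bracket occurs twice, hence a division by `2`.
    have h2 : (2 : ℝ) • (A.sharp H (A.dualL (A.sharp H α) β)
        - A.sharp H (A.dualL (A.sharp H β) α) - A.lie (A.sharp H α) (A.sharp H β)) = 0 := by
      rw [← h]
      module
    exact (smul_eq_zero.1 h2).resolve_left two_ne_zero
  have h1 := hB' (A.dualL x α) β
  have h2 := hB' α (A.dualL x β)
  have h3 := congrArg (A.lie x) (hB' α β)
  have s1 := A.lie_skew (A.sharp H (A.dualL (A.sharp H α) β)) x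
  have s2 := A.lie_skew (A.sharp H (A.dualL (A.sharp H β) α)) x
  have s3 := A.lie_skew (A.lie (A.sharp H α) (A.sharp H β)) x
  have s4 := A.lie_skew (A.sharp H β) (A.sharp H (A.dualL x α))
  have j := A.lie_lie (A.sharp H α) (A.sharp H β) x
  have h0 : A.lie x 0 = 0 := by simp [lie]
  simp only [lie_sub_right, h0] at h3
  simp only [bracketOne, sharp_deltaSec, dualL_add, sharp_add, dualL_lie, sharp_sub, lie_add_right]
  linear_combination (norm := module) h1 + h2 - h3 + s1 - s2 + s4 + j - s3

/-! ### Deformations and the second cohomology group -/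

theorem sum_antidiagonal_one {N : Type*} [AddCommMonoid N] (f : ℕ × ℕ → N) :
    ∑ ij ∈ Finset.HasAntidiagonal.antidiagonal 1, f ij = f (0, 1) + f (1, 0) := by
  simp [Finset.Nat.antidiagonal_succ]

/-- The left side is the first-order deformation equation, an identity of functions; separation by
the dual turns it into the cocycle equation for sections. -/
theorem kv_add_kv_eq_zero_iff [T2Space M] [ContMDiffVectorBundle ∞ F V (𝓡 n)]
    {H K : A.Cochain 1} (hH : H ∈ A.Sym2) (hK : K ∈ A.Sym2) :
    (∀ α β γ, A.kv H K α β γ + A.kv K H α β γ = 0) ↔ A.delta H 1 K = 0 := by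
  rw [delta_one_eq_zero_iff]
  refine ⟨fun h α β => section_eq_zero_of_dual _ fun γ => ?_, fun h α β γ => ?_⟩
  · exact (A.dual_bracketOne hH hK α β γ).trans (h α β γ)
  · rw [← A.dual_bracketOne hH hK, h, map_zero]

theorem IsKoszulVinberg.bracketOne_eq_zero [T2Space M] [ContMDiffVectorBundle ∞ F V (𝓡 n)]
    {A : LeftSymmetricAlgebroid n M F V} {H : A.Cochain 1} (hH : A.IsKoszulVinberg H)
    (α β : A.Dual) : A.bracketOne H H α β = 0 := by
  refine (A.delta_one_eq_zero_iff H H).1 ((A.kv_add_kv_eq_zero_iff hH.1 hH.1).1 ?_) α β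
  intro α β γ
  rw [hH.2, add_zero]

theorem deltaSec_mem_cocycle [T2Space M] [ContMDiffVectorBundle ∞ F V (𝓡 n)]
    {H : A.Cochain 1} (hH : A.IsKoszulVinberg H) {x : A.Cochain 0} (hx : x ∈ A.Tilde H 0) :
    A.deltaSec H (x ![]) ∈ A.TildeCocycle H 1 :=
  ⟨(A.deltaSec_mem_Sym2_iff hH.1 x).2 hx, LinearMap.mem_ker.2 <|
    (A.delta_one_eq_zero_iff _ _).2 (A.bracketOne_deltaSec H (x ![]) hH.bracketOne_eq_zero)⟩

theorem deformation_mem_cocycle [T2Space M] [ContMDiffVectorBundle ∞ F V (𝓡 n)]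
    {H : A.Cochain 1} (h : A.InfinitesimalDeformation H) : h.1 1 ∈ A.TildeCocycle H 1 := by
  obtain ⟨h, h0, hs, -, hk⟩ := h
  have hH : H ∈ A.Sym2 := h0 ▸ hs 0
  refine ⟨hs 1, LinearMap.mem_ker.2 ((A.kv_add_kv_eq_zero_iff hH (hs 1)).1 ?_)⟩
  intro α β γ
  have h1 := hk 1 le_rfl α β γ
  rwa [sum_antidiagonal_one, h0] at h1

/-- The infinitesimal deformation `H + t K` given by a cocycle `K`. -/
def deformationOfCocycle [T2Space M] [ContMDiffVectorBundle ∞ F V (𝓡 n)]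
    {H : A.Cochain 1} (hH : A.IsKoszulVinberg H) {K : A.Cochain 1} (hK : K ∈ A.TildeCocycle H 1) :
    A.InfinitesimalDeformation H :=
  ⟨fun i => if i = 0 then H else if i = 1 then K else 0, by
    refine ⟨rfl, fun i => ?_, fun i hi => ?_, fun k hk α β γ => ?_⟩
    · dsimp only
      split_ifs
      exacts [hH.1, hK.1, A.Sym2.zero_mem]
    · dsimp only
      rw [if_neg (by omega), if_neg (by omega)]
    · obtain rfl | rfl : k = 0 ∨ k = 1 := by omega
      · simpa using hH.2 α β γ
      · rw [sum_antidiagonal_one]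
        exact (A.kv_add_kv_eq_zero_iff hH.1 hK.1).2 (LinearMap.mem_ker.1 hK.2) α β γ⟩

theorem bracket_zero_one_eq_neg_deltaSec (H : A.Cochain 1) (x : A.Cochain 0) :
    A.bracket x H = -⇑(A.deltaSec H (x ![])) := by
  funext u
  rw [Pi.neg_apply, cochain_apply_fin_one, sharp_deltaSec]
  exact A.bracket_zero_one H x u

theorem bracket_zero_left (H : A.Cochain 1) : A.bracket (0 : A.Cochain 0) H = 0 := by
  funext u
  refine (A.bracket_zero_one H 0 u).trans ?_
  have h0 : ∀ ξ : A.Dual, A.dualL 0 ξ = 0 := fun ξ => by simpa using A.dualL_smul 0 0 ξ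
  have h1 : A.sharp H 0 = 0 := by simpa using A.sharp_smul H 0 0
  simp [h0, h1, lie]

theorem expAd_zero (X : ℕ → A.Cochain 0) (T : ℕ → (Fin 1 → A.Dual) → A.Sec) :
    A.expAd X T 0 = T 0 := by
  simp [expAd]

/-- Only `m = 0, 1` contribute, and without a constant term in `X` the linear part is `⟦X 1, h 0⟧`.
-/
theorem expAd_one {X : ℕ → A.Cochain 0} (hX : X 0 = 0) (h : ℕ → A.Cochain 1) :
    A.expAd X (fun i => ⇑(h i)) 1 = ⇑(h 1 - A.deltaSec (h 0) (X 1 ![])) := by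
  have h1 : A.expAd X (fun i => ⇑(h i)) 1
      = ⇑(h 1) + (A.bracket (X 0) (h 1) + A.bracket (X 1) (h 0)) := by
    rw [expAd, Finset.sum_range_succ, Finset.sum_range_one, Function.iterate_zero,
      Function.iterate_one, adSeries, sum_antidiagonal_one]
    simp
  rw [h1, hX, bracket_zero_left, bracket_zero_one_eq_neg_deltaSec, zero_add, sub_eq_add_neg]
  rfl

/-- Infinitesimal deformations are equivalent if and only if they differ by a coboundary. -/
theorem deformationEquiv_iff {H : A.Cochain 1} (h h' : A.InfinitesimalDeformation H) :
    A.DeformationEquiv H 1 h h' ↔ h.1 1 - h'.1 1 ∈ A.TildeCoboundary H 0 := by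
  have hH : H ∈ A.Sym2 := h.2.1 ▸ h.2.2.1 0
  constructor
  · rintro ⟨X, hX, hexp⟩
    have h1 := hexp 1 le_rfl
    rw [A.expAd_one hX, DFunLike.coe_fn_eq, h.2.1] at h1
    have h2 : h.1 1 - h'.1 1 = A.deltaSec H (X 1 ![]) := by rw [← h1, sub_sub_cancel]
    -- Nothing is assumed about `X 1`: it lies in `C̃¹` because its coboundary is a difference of
    -- symmetric tensors.
    refine ⟨X 1, (A.deltaSec_mem_Sym2_iff hH _).1 ?_, ?_⟩
    · rw [← h2]
      exact A.Sym2.sub_mem (h.2.2.1 1) (h'.2.2.1 1)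
    · rw [h2, ← coe_deltaSec]
      rfl
  · rintro ⟨x, hx, hδ⟩
    refine ⟨fun i => if i = 1 then x else 0, rfl, fun k hk => ?_⟩
    obtain rfl | rfl : k = 0 ∨ k = 1 := by omega
    · rw [expAd_zero, h.2.1, h'.2.1]
    · rw [A.expAd_one rfl, DFunLike.coe_fn_eq, h.2.1]
      have h2 : A.deltaSec H (x ![]) = h.1 1 - h'.1 1 :=
        DFunLike.coe_injective ((A.coe_deltaSec H x).trans hδ)
      simp [h2]

end LeftSymmetricAlgebroid
end KoszulVinberg
end

open KoszulVinberg LeftSymmetricAlgebroid in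
theorem proposition6p15 {n : ℕ} {M : Type*} [TopologicalSpace M] [T2Space M] [ParacompactSpace M]
    [ChartedSpace (EuclideanSpace ℝ (Fin n)) M] [IsManifold (𝓡 n) ∞ M]
    {F : Type*} [NormedAddCommGroup F] [NormedSpace ℝ F] [FiniteDimensional ℝ F]
    {V : M → Type*} [TopologicalSpace (Bundle.TotalSpace F V)]
    [∀ p, TopologicalSpace (V p)] [FiberBundle F V]
    [∀ p, AddCommGroup (V p)] [∀ p, Module ℝ (V p)] [VectorBundle ℝ F V]
    [ContMDiffVectorBundle ∞ F V (𝓡 n)]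
    (A : LeftSymmetricAlgebroid n M F V) (H : A.Cochain 1) (hH : A.IsKoszulVinberg H) :
    -- in the degrees that enter the second cohomology, `C̃_KV` is a subcomplex
    (∀ x ∈ A.Tilde H 0, ∃ φ ∈ A.TildeCocycle H 1, ⇑φ = A.delta H 0 x) ∧
    (∀ φ ∈ A.Tilde H 1, ∃ ψ ∈ A.Tilde H 2, ⇑ψ = A.delta H 1 φ) ∧
    -- equivalence of infinitesimal deformations is an equivalence relation, and sending
    -- `H + t H₁` to the class of `H₁` is a well-defined bijection from the set of equivalence
    -- classes onto the second cohomology group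
    Equivalence (A.DeformationEquiv H 1) ∧
    ∃ Φ : Quot (A.DeformationEquiv H 1) ≃ A.TildeCohomology H 0,
      ∀ h : A.InfinitesimalDeformation H, ∃ hc : h.1 1 ∈ A.TildeCocycle H 1,
        Φ (Quot.mk _ h) = Submodule.Quotient.mk ⟨h.1 1, hc⟩ := by
  refine ⟨fun x hx => ⟨_, A.deltaSec_mem_cocycle hH hx, A.coe_deltaSec H x⟩,
    fun φ hφ => ⟨_, A.tilde₃.neg_mem (A.bracketCochain_mem_tilde₃ hH.1 hφ),
      A.coe_neg_bracketCochain H φ⟩, ⟨fun h => ?_, fun {h h'} e => ?_, fun {h h' h''} e e' => ?_⟩, ?_⟩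
  -- The three axioms reduce to the coboundaries being a subspace, so no exponentials are composed
  -- or inverted.
  · rw [deformationEquiv_iff, sub_self]
    exact Submodule.zero_mem _
  · rw [deformationEquiv_iff] at e ⊢
    rw [← neg_sub]
    exact Submodule.neg_mem _ e
  · rw [deformationEquiv_iff] at e e' ⊢
    rw [← sub_add_sub_cancel]
    exact Submodule.add_mem _ e e'
  -- One direction makes the map well defined on classes, the other makes it injective.
  · have key : ∀ h h' : A.InfinitesimalDeformation H, A.DeformationEquiv H 1 h h' ↔
        (Submodule.Quotient.mk ⟨h.1 1, A.deformation_mem_cocycle h⟩ : A.TildeCohomology H 0)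
          = Submodule.Quotient.mk ⟨h'.1 1, A.deformation_mem_cocycle h'⟩ := fun h h' => by
      rw [Submodule.Quotient.eq, deformationEquiv_iff]
      rfl
    refine ⟨Equiv.ofBijective (Quot.lift (fun h => Submodule.Quotient.mk
      ⟨h.1 1, A.deformation_mem_cocycle h⟩) fun h h' e => (key h h').1 e) ⟨?_, ?_⟩,
      fun h => ⟨A.deformation_mem_cocycle h, rfl⟩⟩
    · rintro ⟨h⟩ ⟨h'⟩ e
      exact Quot.sound ((key h h').2 e)
    · intro c
      obtain ⟨⟨K, hK⟩, rfl⟩ := Submodule.Quotient.mk_surjective _ c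
      exact ⟨Quot.mk _ (A.deformationOfCocycle hH hK), rfl⟩
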